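/- Fix real numbers $\beta_0,\beta_1$ and $\tau^2\ge 0$. In the structural Berkson logistic regression model with parameters $(\beta_0,\beta_1,\tau^2)$, one trial consists of real random variables $X_0$, $U$, $X$ and a $\{0,1\}$-valued random variable $Y$ on a probability space such that $X = X_0+U$, the error $U\sim N(0,\tau^2)$ is independent of $X_0$ (where $N(0,0)$ is the point mass at $0$), and almost surely $$\mathsf P(Y=1\mid X_0,X)=\frac{\exp(\beta_0+\beta_1X)}{1+\exp(\beta_0+\beta_1X)} .$$ Only $(X_0,Y)$ is observed; all of $\beta_0,\beta_1,\tau^2$ are unknown. **Theorem.** Suppose that the distribution of the surrogate regressor $X_0$ is not concentrated at three or fewer points, i.e. $\mathsf P(X_0\in S)<1$ for every set $S\subset\mathbb R$ with at most three elements. Then the parameters $\beta=(\beta_0,\beta_1)$ and $\beta_1^2\tau^2$ are identifiable from the joint law of $(X_0,Y)$: if $(X_0,Y)$ arises from the model with parameters $(\beta_0,\beta_1,\tau^2)$, $(X_0',Y')$ arises from the model (possibly on another probability space) with parameters $(\beta_0',\beta_1',(\tau')^2)$, and the pairs $(X_0,Y)$ and $(X_0',Y')$ have the same distribution, then $$\beta_0=\beta_0',\qquad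 \beta_1=\beta_1',\qquad \beta_1^2\tau^2=(\beta_1')^2(\tau')^2 .$$ -/

import Mathlib

open MeasureTheory ProbabilityTheory
open scoped NNReal

/-- The parameters of the Berkson logistic model: the regression coefficients `β₀`, `β₁` and the
error variance `τ² ≥ 0`. -/
structure BerksonParam where
  β₀ : ℝ
  β₁ : ℝ
  tauSq : ℝ≥0

/-- One trial of the structural Berkson logistic regression model with parameter `θ`, on a
probability space `(Ω, P)`: `X₀` is the (random) surrogate regressor, `X = X₀ + U` is the true
regressor, the error `U ∼ N(0, τ²)` is independent of `X₀`, and the binary response `Y` satisfies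
`P(Y = 1 | X₀, X) = exp (β₀ + β₁ X) / (1 + exp (β₀ + β₁ X))` almost surely. -/
structure IsStructuralBerksonLogistic {Ω : Type*} [MeasurableSpace Ω] (P : Measure Ω)
    (X₀ U X : Ω → ℝ) (Y : Ω → Fin 2) (θ : BerksonParam) : Prop where
  isProbabilityMeasure : IsProbabilityMeasure P
  measurable_X₀ : Measurable X₀
  measurable_U : Measurable U
  measurable_Y : Measurable Y
  X_eq : ∀ ω, X ω = X₀ ω + U ω
  law_U : P.map U = gaussianReal 0 θ.tauSq
  indep : IndepFun X₀ U P
  condProb :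
    P⟦Y ⁻¹' {1} | MeasurableSpace.comap (fun ω => (X₀ ω, X ω)) inferInstance⟧ =ᵐ[P]
      fun ω => Real.exp (θ.β₀ + θ.β₁ * X ω) / (1 + Real.exp (θ.β₀ + θ.β₁ * X ω))

/-! The law of `(X₀, Y)` determines the response `P(Y = 1 | X₀ = x)` up to null sets, so it suffices
that responses with distinguishable parameters agree in at most three points
(`encard_berksonResponse_eq_le`). Convolution with a Gaussian does not increase the number of zeros:
by Cameron-Martin it is a rescaled Laplace transform, and Rolle's theorem bounds the zeros of such a
transform by the sign changes of the integrand. Stripping the smaller variance from both responses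
leaves a Berkson response minus a plain logistic one. Times the logistic denominator, this is again
a Gaussian convolution, of a function that is a positive factor times a sum of four exponentials.
Such a sum has at most three zeros unless it vanishes identically, and then its power moments force
the parameters to agree. -/

/-! ### Zeros of exponential sums -/

/-- **Rolle's theorem**, counting version: a differentiable function has at most one more zero than
its derivative. -/
theorem encard_zeros_le_encard_zeros_deriv_add_one {f f' : ℝ → ℝ}
    (hf : ∀ x, HasDerivAt f (f' x) x) :
    {x | f x = 0}.encard ≤ {x | f' x = 0}.encard + 1 := by
  by_contra! hlt
  have hfin : {x | f' x = 0}.encard ≠ ⊤ := by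
    intro h
    simp [h] at hlt
  obtain ⟨n, hn⟩ := ENat.ne_top_iff_exists.1 hfin
  rw [← hn] at hlt
  have hle : ((n + 2 : ℕ) : ℕ∞) ≤ {x | f x = 0}.encard := by
    have := Order.add_one_le_of_lt hlt
    exact_mod_cast this
  obtain ⟨T, hT, hTcard⟩ := Set.exists_subset_encard_eq hle
  have hTfin : T.Finite := Set.finite_of_encard_eq_coe hTcard
  have hcard : hTfin.toFinset.card = n + 2 := by
    rw [hTfin.encard_eq_coe_toFinset_card] at hTcard
    exact_mod_cast hTcard
  let e := hTfin.toFinset.orderEmbOfFin hcard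
  have he : ∀ i, f (e i) = 0 := fun i =>
    hT (hTfin.mem_toFinset.1 (Finset.orderEmbOfFin_mem _ hcard i))
  have hrolle : ∀ i : Fin (n + 1), ∃ c ∈ Set.Ioo (e i.castSucc) (e i.succ), f' c = 0 := fun i =>
    exists_hasDerivAt_eq_zero (e.strictMono i.castSucc_lt_succ)
      (fun x _ => (hf x).continuousAt.continuousWithinAt) ((he _).trans (he _).symm)
      fun x _ => hf x
  choose c hc hc0 using hrolle
  have hmono : StrictMono c := Fin.strictMono_iff_lt_succ.2 fun i =>
    (hc _).2.trans (by simpa using (hc i.succ).1)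
  have hsub : Set.range c ⊆ {x | f' x = 0} := by
    rintro _ ⟨i, rfl⟩
    exact hc0 i
  have := Set.encard_le_encard hsub
  rw [← hn, ← Set.image_univ, hmono.injective.encard_image] at this
  simp only [Set.encard_univ, ENat.card_eq_coe_fintype_card, Fintype.card_fin] at this
  have : n + 1 ≤ n := by exact_mod_cast this
  omega

/-- A nonzero exponential sum with `n + 1` terms has at most `n` zeros. -/
theorem encard_zeros_exp_sum_le (n : ℕ) (c a : Fin (n + 1) → ℝ)
    (hne : ∃ t, ∑ i, c i * Real.exp (a i * t) ≠ 0) :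
    {t | ∑ i, c i * Real.exp (a i * t) = 0}.encard ≤ n := by
  induction n with
  | zero =>
    obtain ⟨t, ht⟩ := hne
    have hc : c 0 ≠ 0 := by
      rintro h
      simp [h] at ht
    simp [hc]
  | succ n ih =>
    -- Making the first exponent zero lets differentiation kill that term, at the cost of one zero
    -- by Rolle.
    have hshift : ∀ t, ∑ i, c i * Real.exp ((a i - a 0) * t) =
        Real.exp (-(a 0 * t)) * ∑ i, c i * Real.exp (a i * t) := by
      intro t
      rw [Finset.mul_sum]
      refine Finset.sum_congr rfl fun i _ => ?_
      rw [mul_left_comm, ← Real.exp_add]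
      ring_nf
    have hset : {t | ∑ i, c i * Real.exp (a i * t) = 0} =
        {t | ∑ i, c i * Real.exp ((a i - a 0) * t) = 0} := by
      ext t
      simp [hshift]
    have hder : ∀ t, HasDerivAt (fun t => ∑ i, c i * Real.exp ((a i - a 0) * t))
        (∑ i : Fin (n + 1), (c i.succ * (a i.succ - a 0)) *
          Real.exp ((a i.succ - a 0) * t)) t := by
      intro t
      have h : HasDerivAt (fun t => ∑ i, c i * Real.exp ((a i - a 0) * t))
          (∑ i, c i * (Real.exp ((a i - a 0) * t) * ((a i - a 0) * 1))) t :=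
        HasDerivAt.fun_sum fun i _ =>
          (((hasDerivAt_id t).const_mul (a i - a 0)).exp).const_mul (c i)
      refine h.congr_deriv ?_
      rw [Fin.sum_univ_succ (f := fun i => c i * (Real.exp ((a i - a 0) * t) * ((a i - a 0) * 1)))]
      simp only [sub_self, mul_one, mul_zero, zero_add]
      exact Finset.sum_congr rfl fun i _ => by ring
    rw [hset]
    by_cases h0 : ∃ t, ∑ i : Fin (n + 1), (c i.succ * (a i.succ - a 0)) *
        Real.exp ((a i.succ - a 0) * t) ≠ 0
    · exact (encard_zeros_le_encard_zeros_deriv_add_one hder).trans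
        (by push_cast; gcongr; exact ih _ _ h0)
    · push Not at h0
      have hconst := is_const_of_deriv_eq_zero (fun t => (hder t).differentiableAt)
        fun t => (hder t).deriv.trans (h0 t)
      obtain ⟨s, hs⟩ := hne
      have hs' : ∑ i, c i * Real.exp ((a i - a 0) * s) ≠ 0 := by
        rw [hshift]
        exact mul_ne_zero (Real.exp_ne_zero _) hs
      have hempty : {t | ∑ i, c i * Real.exp ((a i - a 0) * t) = 0} = ∅ := by
        ext t
        simpa [hconst t s] using hs'
      simp [hempty]

/-! ### Zeros and sign changes under Laplace and Gaussian transforms -/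

/-- Differentiation under the integral sign for a two-sided Laplace transform. -/
theorem hasDerivAt_integral_exp_mul {μ : Measure ℝ} {d : ℝ → ℝ}
    (hint : ∀ x, Integrable (fun t => Real.exp (x * t) * d t) μ) (x : ℝ) :
    Integrable (fun t => t * (Real.exp (x * t) * d t)) μ ∧
    HasDerivAt (fun x => ∫ t, Real.exp (x * t) * d t ∂μ)
      (∫ t, t * (Real.exp (x * t) * d t) ∂μ) x := by
  refine hasDerivAt_integral_of_dominated_loc_of_deriv_le (s := Metric.ball x 1)
    (F' := fun x t => t * (Real.exp (x * t) * d t))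
    (bound := fun t => ‖Real.exp ((x + 2) * t) * d t‖ + ‖Real.exp ((x - 2) * t) * d t‖)
    (Metric.ball_mem_nhds x one_pos) (.of_forall fun y => (hint y).aestronglyMeasurable) (hint x)
    (aestronglyMeasurable_id.mul (hint x).aestronglyMeasurable) (.of_forall fun t y hy => ?_)
    ((hint _).norm.add (hint _).norm) (.of_forall fun t y _ => ?_)
  · have hy' : |y - x| ≤ 1 := by simpa [Real.dist_eq] using (Metric.mem_ball.1 hy).le
    simp only [norm_mul, Real.norm_eq_abs, Real.abs_exp]
    rw [← mul_assoc, ← add_mul]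
    gcongr
    -- One `|t|` in the exponent absorbs the factor `t`, the other the move from `x` to `y`; hence
    -- the `x ± 2` in the bound.
    have h1 : |t| ≤ Real.exp |t| := by linarith [Real.add_one_le_exp |t|]
    have h2 : y * t ≤ x * t + |t| := by
      have : (y - x) * t ≤ |t| := (le_abs_self _).trans
        (by rw [abs_mul]; exact mul_le_of_le_one_left (abs_nonneg t) hy')
      linarith
    calc |t| * Real.exp (y * t) ≤ Real.exp |t| * Real.exp (x * t + |t|) := by gcongr
      _ = Real.exp (x * t + 2 * |t|) := by rw [← Real.exp_add]; ring_nf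
      _ ≤ _ := by
        rcases abs_cases t with ⟨h, _⟩ | ⟨h, _⟩ <;> rw [h]
        · rw [show x * t + 2 * t = (x + 2) * t by ring]
          exact le_add_of_nonneg_right (Real.exp_nonneg _)
        · rw [show x * t + 2 * -t = (x - 2) * t by ring]
          exact le_add_of_nonneg_left (Real.exp_nonneg _)
  · have h := (((hasDerivAt_id y).mul_const t).exp).mul_const (d t)
    exact h.congr_deriv (by simp only [id]; ring)

/-- The Laplace transform of a function whose sign changes only at points of `Z` has at most
`Z.card` zeros. -/
theorem encard_zeros_laplace_le_card {μ : Measure ℝ} [NullSingletonClass μ] [NeZero μ]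
    (Z : Finset ℝ) (d : ℝ → ℝ) (hint : ∀ x, Integrable (fun t => Real.exp (x * t) * d t) μ)
    (hae : ∀ᵐ t ∂μ, d t ≠ 0) (hZ : ∀ z ∈ Z, d z = 0)
    (hsign : ∀ x y, d x ≠ 0 → d y ≠ 0 → x < y → (∀ z ∈ Z, z ∉ Set.Ioo x y) → 0 < d x * d y) :
    {x | ∫ t, Real.exp (x * t) * d t ∂μ = 0}.encard ≤ Z.card := by
  induction Z using Finset.induction_on generalizing d with
  | empty =>
    obtain ⟨s, hs⟩ := hae.exists
    suffices h : {x | ∫ t, Real.exp (x * t) * d t ∂μ = 0} = ∅ by simp [h]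
    refine Set.eq_empty_of_forall_notMem fun x (hx : _ = 0) => ?_
    have hnonneg : ∀ t, 0 ≤ d s * (Real.exp (x * t) * d t) := by
      intro t
      rw [mul_left_comm]
      refine mul_nonneg (Real.exp_nonneg _) ?_
      by_cases ht : d t = 0
      · simp [ht]
      rcases lt_trichotomy s t with h | rfl | h
      · exact (hsign s t hs ht h (by simp)).le
      · exact mul_self_nonneg _
      · rw [mul_comm]
        exact (hsign t s ht hs h (by simp)).le
    have hzero := (integral_eq_zero_iff_of_nonneg hnonneg ((hint x).const_mul (d s))).1
      (by rw [integral_const_mul, hx, mul_zero])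
    obtain ⟨t, ht, ht'⟩ := (hzero.and hae).exists
    simp [hs, ht'] at ht
  | insert a Z ha ih =>
    rw [Finset.card_insert_of_notMem ha]
    have hZ' : ∀ z ∈ Z, d z = 0 := fun z hz => hZ z (Finset.mem_insert_of_mem hz)
    -- Does `d` really change sign across `a`? If not, `a` can be dropped from the list.
    by_cases hch : ∃ x y, d x ≠ 0 ∧ d y ≠ 0 ∧ x < a ∧ a < y ∧ (∀ z ∈ Z, z ∉ Set.Ioo x y) ∧
        d x * d y ≤ 0
    · obtain ⟨p, q, hp, hq, hpa, haq, hpq, hneg⟩ := hch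
      replace hneg : d p * d q < 0 := lt_of_le_of_ne hneg (mul_ne_zero hp hq)
      have key := hasDerivAt_integral_exp_mul hint
      -- The factor `exp (-(a * x))` keeps the zeros, and differentiating then replaces `d` by `(t -
      -- a) * d`, which no longer changes sign at `a`.
      have hder : ∀ x, HasDerivAt
          (fun x => Real.exp (-(a * x)) * ∫ t, Real.exp (x * t) * d t ∂μ)
          (Real.exp (-(a * x)) * ∫ t, Real.exp (x * t) * ((t - a) * d t) ∂μ) x := by
        intro x
        have h := (((hasDerivAt_id x).const_mul a).neg.exp).mul (key x).2
        have hsub : ∫ t, Real.exp (x * t) * ((t - a) * d t) ∂μ =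
            ∫ t, t * (Real.exp (x * t) * d t) ∂μ - a * ∫ t, Real.exp (x * t) * d t ∂μ := by
          rw [← integral_const_mul, ← integral_sub (key x).1 ((hint x).const_mul a)]
          exact integral_congr_ae (.of_forall fun t => by ring)
        exact h.congr_deriv (by rw [hsub]; simp only [id, Pi.neg_apply]; ring)
      have hroll := encard_zeros_le_encard_zeros_deriv_add_one hder
      simp only [mul_eq_zero, Real.exp_ne_zero, false_or] at hroll
      refine hroll.trans ?_
      push_cast
      gcongr
      refine ih (fun t => (t - a) * d t) (fun x => ?_) ?_ (fun z hz => by simp [hZ' z hz]) ?_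
      · exact ((key x).1.sub ((hint x).const_mul a)).congr
          (.of_forall fun t => by simp only [Pi.sub_apply]; ring)
      · have : ∀ᵐ t ∂μ, t ≠ a := compl_mem_ae_iff.2 (measure_singleton a)
        filter_upwards [this, hae] with t h1 h2
        exact mul_ne_zero (sub_ne_zero.2 h1) h2
      · intro x y hx hy hxy hxyZ
        have hxa : x ≠ a := fun h => by simp [h] at hx
        have hya : y ≠ a := fun h => by simp [h] at hy
        replace hx : d x ≠ 0 := right_ne_zero_of_mul hx
        replace hy : d y ≠ 0 := right_ne_zero_of_mul hy
        have hside : ∀ u v, d u ≠ 0 → d v ≠ 0 → (∀ z ∈ Z, z ∉ Set.Ioo (min u v) (max u v)) →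
            (a ∉ Set.Ioo (min u v) (max u v)) → 0 < d u * d v := by
          intro u v hu hv huv hauv
          have hall : ∀ z ∈ insert a Z, z ∉ Set.Ioo (min u v) (max u v) :=
            (Finset.forall_mem_insert _ _ _).2 ⟨hauv, huv⟩
          rcases lt_trichotomy u v with h | rfl | h
          · rw [min_eq_left h.le, max_eq_right h.le] at hall
            exact hsign u v hu hv h hall
          · exact mul_self_pos.2 hu
          · rw [min_eq_right h.le, max_eq_left h.le] at hall
            rw [mul_comm]
            exact hsign v u hv hu h hall
        have hxy' : a ∉ Set.Ioo x y → 0 < d x * d y := fun h =>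
          hside x y hx hy (by rwa [min_eq_left hxy.le, max_eq_right hxy.le])
            (by rwa [min_eq_left hxy.le, max_eq_right hxy.le])
        suffices h : 0 < ((x - a) * (y - a)) * (d x * d y) by
          calc _ < _ := h
            _ = _ := by ring
        rcases lt_or_gt_of_ne hxa with h1 | h1
        · rcases lt_or_gt_of_ne hya with h2 | h2
          · exact mul_pos (mul_pos_of_neg_of_neg (sub_neg.2 h1) (sub_neg.2 h2))
              (hxy' fun h => h2.not_gt h.2)
          -- Both `(x, y)` and `(p, q)` straddle `a` and avoid `Z`, so `d` has the same sign at `x`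
          -- and `p`, and at `y` and `q`.
          · refine mul_pos_of_neg_of_neg
              (mul_neg_of_neg_of_pos (sub_neg.2 h1) (sub_pos.2 h2)) ?_
            have hzx : ∀ z ∈ Z, z ≠ a := fun z hz h => ha (h ▸ hz)
            have hxp : 0 < d x * d p := by
              refine hside x p hx hp (fun z hz hz' => ?_) (fun h => ?_)
              · have := hpq z hz
                have := hxyZ z hz
                have := hzx z hz
                simp only [Set.mem_Ioo, min_lt_iff, lt_max_iff] at *
                grind
              · simp only [Set.mem_Ioo, lt_max_iff] at h
                grind
            have hyq : 0 < d y * d q := by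
              refine hside y q hy hq (fun z hz hz' => ?_) (fun h => ?_)
              · have := hpq z hz
                have := hxyZ z hz
                have := hzx z hz
                simp only [Set.mem_Ioo, min_lt_iff, lt_max_iff] at *
                grind
              · simp only [Set.mem_Ioo, min_lt_iff] at h
                grind
            have hprod : 0 < (d x * d y) * (d p * d q) := by
              calc 0 < (d x * d p) * (d y * d q) := mul_pos hxp hyq
                _ = _ := by ring
            exact neg_of_mul_pos_left hprod hneg.le
        · have h2 := h1.trans hxy
          exact mul_pos (mul_pos (sub_pos.2 h1) (sub_pos.2 h2)) (hxy' fun h => h1.not_gt h.1)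
    · push Not at hch
      refine (ih d hint hae hZ' fun x y hx hy hxy hxyZ => ?_).trans (by push_cast; exact le_self_add)
      by_cases hmem : a ∈ Set.Ioo x y
      · exact hch x y hx hy hmem.1 hmem.2 hxyZ
      · exact hsign x y hx hy hxy ((Finset.forall_mem_insert _ _ _).2 ⟨hmem, hxyZ⟩)

/-- The Laplace transform of a continuous function `d` has at most as many zeros as `d`. -/
theorem encard_zeros_laplace_le {μ : Measure ℝ} [NullSingletonClass μ] [NeZero μ] {d : ℝ → ℝ}
    (hd : Continuous d) (hint : ∀ x, Integrable (fun t => Real.exp (x * t) * d t) μ) :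
    {x | ∫ t, Real.exp (x * t) * d t ∂μ = 0}.encard ≤ {t | d t = 0}.encard := by
  by_cases hfin : {t | d t = 0}.Finite
  · rw [hfin.encard_eq_coe_toFinset_card]
    refine encard_zeros_laplace_le_card _ d hint ?_ (by simp) ?_
    · exact compl_mem_ae_iff.2 (hfin.measure_zero μ)
    · intro x y hx hy hxy h
      simp only [Set.Finite.mem_toFinset, Set.mem_ofPred_eq] at h
      by_contra! hle
      have h0 : (0 : ℝ) ∈ d '' Set.uIcc x y := by
        refine intermediate_value_uIcc hd.continuousOn ?_
        rw [Set.mem_uIcc]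
        rcases mul_nonpos_iff.1 hle with h | h
        · exact .inr ⟨h.2, h.1⟩
        · exact .inl h
      obtain ⟨z, hz, hz0⟩ := h0
      rw [Set.uIcc_of_le hxy.le] at hz
      refine h z hz0 ⟨lt_of_le_of_ne hz.1 ?_, lt_of_le_of_ne hz.2 ?_⟩
      · rintro rfl
        exact hx hz0
      · rintro rfl
        exact hy hz0
  · rw [Set.Infinite.encard_eq hfin]
    exact le_top

/-- The Cameron-Martin formula for a centred real Gaussian law. -/
theorem integral_add_mul_gaussianReal (v : ℝ≥0) (g : ℝ → ℝ) (y : ℝ) :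
    ∫ u, g (u + v * y) ∂gaussianReal 0 v =
      Real.exp (-(v * y ^ 2 / 2)) * ∫ u, Real.exp (y * u) * g u ∂gaussianReal 0 v := by
  rcases eq_or_ne v 0 with rfl | hv
  · simp [gaussianReal_zero_var]
  have hv' : (v : ℝ) ≠ 0 := by exact_mod_cast hv
  rw [integral_gaussianReal_eq_integral_smul hv, integral_gaussianReal_eq_integral_smul hv,
    ← integral_add_right_eq_self _ (-(v * y)), ← integral_const_mul]
  refine integral_congr_ae (.of_forall fun u => ?_)
  simp only [neg_add_cancel_right, smul_eq_mul, gaussianPDFReal, sub_zero]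
  have h : Real.exp (-(u + -(v * y)) ^ 2 / (2 * v)) =
      Real.exp (-(v * y ^ 2 / 2)) * Real.exp (-u ^ 2 / (2 * v)) * Real.exp (y * u) := by
    rw [← Real.exp_add, ← Real.exp_add]
    congr 1
    field_simp
    ring
  rw [h]
  ring

/-- Convolution with a centred Gaussian law does not increase the number of zeros. -/
theorem encard_zeros_gaussian_conv_le {v : ℝ≥0} {g : ℝ → ℝ} (hg : Continuous g)
    (hint : ∀ y, Integrable (fun u => Real.exp (y * u) * g u) (gaussianReal 0 v)) :
    {x | ∫ u, g (x + u) ∂gaussianReal 0 v = 0}.encard ≤ {t | g t = 0}.encard := by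
  rcases eq_or_ne v 0 with rfl | hv
  · simp [gaussianReal_zero_var]
  have hv' : (v : ℝ) ≠ 0 := by exact_mod_cast hv
  have := nullSingletonClass_gaussianReal (μ := 0) hv
  -- Cameron-Martin at `x = v * y`.
  have hsub : {x | ∫ u, g (x + u) ∂gaussianReal 0 v = 0} ⊆
      (fun y : ℝ => v * y) '' {y | ∫ u, Real.exp (y * u) * g u ∂gaussianReal 0 v = 0} := by
    intro x hx
    refine ⟨x / v, ?_, mul_div_cancel₀ x hv'⟩
    have h := integral_add_mul_gaussianReal v g (x / v)
    rw [mul_div_cancel₀ x hv'] at h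
    simp_rw [add_comm _ x] at h
    rw [show ∫ u, g (x + u) ∂gaussianReal 0 v = 0 from hx] at h
    exact (mul_eq_zero.1 h.symm).resolve_left (Real.exp_ne_zero _)
  exact (Set.encard_le_encard hsub).trans
    ((Set.encard_image_le _ _).trans (encard_zeros_laplace_le hg hint))

theorem integrable_exp_mul_mul_gaussianReal (v : ℝ≥0) (y C : ℝ) {b : ℝ → ℝ} (hb : Continuous b)
    (hbC : ∀ u, |b u| ≤ C) :
    Integrable (fun u => Real.exp (y * u) * b u) (gaussianReal 0 v) :=
  (integrable_exp_mul_gaussianReal y).mul_bdd hb.aestronglyMeasurable (.of_forall hbC)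

/-! ### Moments, and the Berkson response -/

/-- If an exponential sum vanishes identically, so do all its power moments. -/
theorem sum_mul_pow_eq_zero_of_exp_sum_eq_zero {n : ℕ} {c a : Fin n → ℝ}
    (h : ∀ t, ∑ i, c i * Real.exp (a i * t) = 0) (k : ℕ) : ∑ i, c i * a i ^ k = 0 := by
  suffices hk : ∀ t, ∑ i, c i * a i ^ k * Real.exp (a i * t) = 0 by simpa using hk 0
  induction k with
  | zero => simpa using h
  | succ k ih =>
    intro t
    have h1 : HasDerivAt (fun t => ∑ i, c i * a i ^ k * Real.exp (a i * t))
        (∑ i, c i * a i ^ k * (Real.exp (a i * t) * (a i * 1))) t :=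
      HasDerivAt.fun_sum fun i _ => (((hasDerivAt_id t).const_mul (a i)).exp).const_mul _
    have h2 : HasDerivAt (fun t => ∑ i, c i * a i ^ k * Real.exp (a i * t)) 0 t := by
      simp_rw [ih]
      exact hasDerivAt_const t 0
    rw [← h1.unique h2]
    exact Finset.sum_congr rfl fun i _ => by ring

/-- The response probability `P(Y = 1 | X₀ = x)` in the Berkson logistic model. -/
noncomputable def berksonResponse (b₀ b₁ : ℝ) (v : ℝ≥0) (x : ℝ) : ℝ :=
  ∫ u, Real.sigmoid (b₀ + b₁ * (x + u)) ∂gaussianReal 0 v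

theorem abs_sigmoid_le_one (x : ℝ) : |Real.sigmoid x| ≤ 1 := by
  rw [abs_of_nonneg (Real.sigmoid_nonneg x)]
  exact Real.sigmoid_le_one x

theorem continuous_sigmoid_affine (b₀ b₁ : ℝ) : Continuous fun t => Real.sigmoid (b₀ + b₁ * t) :=
  continuous_sigmoid.comp (by fun_prop)

theorem integrable_sigmoid_comp {α : Type*} [MeasurableSpace α] (μ : Measure α) [IsFiniteMeasure μ]
    {f : α → ℝ} (hf : Measurable f) : Integrable (fun x => Real.sigmoid (f x)) μ :=
  Integrable.of_bound (continuous_sigmoid.measurable.comp hf).aestronglyMeasurable 1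
    (.of_forall fun _ => abs_sigmoid_le_one _)

theorem continuous_berksonResponse (b₀ b₁ : ℝ) (v : ℝ≥0) : Continuous (berksonResponse b₀ b₁ v) := by
  refine continuous_of_dominated (bound := fun _ => 1) (fun x => ?_)
    (fun x => .of_forall fun u => abs_sigmoid_le_one _) (integrable_const _)
    (.of_forall fun u => continuous_sigmoid.comp (by fun_prop))
  exact (integrable_sigmoid_comp _ (by fun_prop)).aestronglyMeasurable

theorem abs_berksonResponse_le_one (b₀ b₁ : ℝ) (v : ℝ≥0) (x : ℝ) :
    |berksonResponse b₀ b₁ v x| ≤ 1 := by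
  simpa [berksonResponse] using norm_integral_le_of_norm_le_const (μ := gaussianReal 0 v)
    (f := fun u => Real.sigmoid (b₀ + b₁ * (x + u))) (.of_forall fun _ => abs_sigmoid_le_one _)

/-- Gaussian variances add under convolution; this lets a common part of two error variances be
split off. -/
theorem berksonResponse_add (b₀ b₁ : ℝ) (v w : ℝ≥0) (x : ℝ) :
    berksonResponse b₀ b₁ (v + w) x = ∫ u, berksonResponse b₀ b₁ w (x + u) ∂gaussianReal 0 v := by
  have h : gaussianReal 0 (v + w) = gaussianReal 0 v ∗ gaussianReal 0 w := by
    rw [gaussianReal_conv_gaussianReal, add_zero]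
  rw [berksonResponse, h, integral_conv (integrable_sigmoid_comp _ (by fun_prop))]
  simp only [berksonResponse, add_assoc]

/-- An exponential sum with the zeros of the difference between a Berkson and a logistic
response is identically zero only if the parameters agree. -/
theorem eq_of_exp_sum_eq_zero {b₀ b₁ b₀' b₁' w : ℝ}
    (h : ∀ t, ∑ i, ![-1, -Real.exp (-b₀ - b₁ * (w * b₁')), Real.exp (-b₀' - w * b₁' ^ 2 / 2),
        Real.exp (-b₀' - w * b₁' ^ 2 / 2) * Real.exp b₀] i *
      Real.exp (![0, -b₁, -b₁', b₁ - b₁'] i * t) = 0) :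
    b₀ = b₀' ∧ b₁ = b₁' ∧ b₁ ^ 2 * w = 0 := by
  have hm := sum_mul_pow_eq_zero_of_exp_sum_eq_zero h
  have h0 := hm 0
  have h1 := hm 1
  have h2 := hm 2
  have h3 := hm 3
  simp only [Fin.sum_univ_four, Matrix.cons_val] at h0 h1 h2 h3
  set A := Real.exp (-b₀' - w * b₁' ^ 2 / 2) with hA
  set B := Real.exp b₀ with hB
  set C := Real.exp (-b₀ - b₁ * (w * b₁')) with hC
  have hA0 : 0 < A := Real.exp_pos _
  have hB0 : 0 < B := Real.exp_pos _
  have hb : b₁ = b₁' := by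
    by_contra hne
    have hsub : A * (b₁ - b₁') ≠ 0 := mul_ne_zero hA0.ne' (sub_ne_zero.2 hne)
    -- Adding `b₁` times one moment to the next eliminates `C`; the common factor `A * (b₁ - b₁')`
    -- then cancels.
    have e1 : b₁' = B * (2 * b₁ - b₁') := by
      apply mul_left_cancel₀ hsub
      linear_combination -h2 - b₁ * h1
    have e2 : b₁' ^ 2 + B * (b₁ - b₁') * (2 * b₁ - b₁') = 0 := by
      apply mul_left_cancel₀ hsub
      linear_combination h3 + b₁ * h2
    have e3 : b₁ * b₁' = 0 := by linear_combination e2 + (b₁ - b₁') * e1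
    rcases mul_eq_zero.1 e3 with h | h
    · have : (1 + B) * b₁' = 0 := by rw [h] at e1; linear_combination e1
      have hb' := (mul_eq_zero.1 this).resolve_left (by positivity)
      exact hne (h.trans hb'.symm)
    · have : B * (2 * b₁) = 0 := by rw [h] at e1; linear_combination -e1
      have hb' := (mul_eq_zero.1 this).resolve_left hB0.ne'
      exact hne (by linarith)
  subst hb
  rcases eq_or_ne b₁ 0 with rfl | hb1
  · refine ⟨?_, rfl, by ring⟩
    have hC' : C * B = 1 := by rw [hC, hB, ← Real.exp_add]; simp
    have hAB : (A * B - 1) * (1 + B) = 0 := by linear_combination B * h0 + hC'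
    have hAB' : A * B = 1 := by
      linarith [(mul_eq_zero.1 hAB).resolve_right (by positivity)]
    rw [hA, hB, ← Real.exp_add, Real.exp_eq_one_iff] at hAB'
    linarith
  · have hAC : A = C := by
      apply mul_left_cancel₀ hb1
      linear_combination -h1
    have hCB : C * B = 1 := by
      rw [hAC] at h0
      linear_combination h0
    have hAB := hAC ▸ hCB
    rw [hC, hB, ← Real.exp_add, Real.exp_eq_one_iff] at hCB
    have hw0 : b₁ ^ 2 * w = 0 := by linear_combination -hCB
    rw [hA, hB, ← Real.exp_add, Real.exp_eq_one_iff] at hAB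
    exact ⟨by linarith, rfl, hw0⟩

/-! ### Counting coincidences of two responses -/

/-- A Berkson response and a logistic response with different parameters agree in at most three
points. -/
theorem encard_berksonResponse_eq_sigmoid_le {b₀ b₁ b₀' b₁' : ℝ} {w : ℝ≥0}
    (hne : ¬ (b₀ = b₀' ∧ b₁ = b₁' ∧ b₁ ^ 2 * (w : ℝ) = 0)) :
    {x | berksonResponse b₀ b₁ w x - Real.sigmoid (b₀' + b₁' * x) = 0}.encard ≤ 3 := by
  set A := Real.exp (-b₀' - w * b₁' ^ 2 / 2) with hA
  -- Multiplying the difference by `1 + exp (-(b₀' + b₁' * x))` tilts the response exponentially;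
  -- Cameron-Martin moves the tilt inside the convolution, producing the shift `w * b₁'` and the
  -- constant `A`.
  let g : ℝ → ℝ := fun t => (Real.sigmoid (b₀ + b₁ * t) - 1) +
    A * Real.exp (-b₁' * t) * Real.sigmoid (b₀ + b₁ * (t + w * b₁'))
  have hgc : Continuous g := by
    have h1 := continuous_sigmoid_affine b₀ b₁
    have h2 : Continuous fun t => Real.sigmoid (b₀ + b₁ * (t + w * b₁')) :=
      h1.comp (continuous_add_const _)
    fun_prop
  have hint1 : ∀ x y, Integrable (fun u => Real.exp (y * u) * Real.sigmoid (b₀ + b₁ * (x + u)))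
      (gaussianReal 0 w) := fun x y =>
    integrable_exp_mul_mul_gaussianReal w y 1 (continuous_sigmoid.comp (by fun_prop))
      fun u => abs_sigmoid_le_one _
  have hgint : ∀ y, Integrable (fun u => Real.exp (y * u) * g u) (gaussianReal 0 w) := by
    intro y
    refine (((hint1 0 y).sub (integrable_exp_mul_gaussianReal y)).add
      ((hint1 (w * b₁') (y - b₁')).const_mul A)).congr (.of_forall fun u => ?_)
    have he : Real.exp ((y - b₁') * u) = Real.exp (y * u) * Real.exp (-b₁' * u) := by
      rw [← Real.exp_add]
      ring_nf
    simp only [g, Pi.add_apply, Pi.sub_apply]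
    rw [he, zero_add, add_comm (w * b₁')]
    ring
  have hconv : ∀ x, ∫ u, g (x + u) ∂gaussianReal 0 w =
      (1 + Real.exp (-(b₀' + b₁' * x))) *
        (berksonResponse b₀ b₁ w x - Real.sigmoid (b₀' + b₁' * x)) := by
    intro x
    have hcm := integral_add_mul_gaussianReal w
      (fun u => Real.exp (-b₁' * (x + u - w * b₁')) * Real.sigmoid (b₀ + b₁ * (x + u))) b₁'
    have hfun : ∀ u, Real.exp (b₁' * u) *
        (Real.exp (-b₁' * (x + u - w * b₁')) * Real.sigmoid (b₀ + b₁ * (x + u))) =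
        Real.exp (-b₁' * x + w * b₁' ^ 2) * Real.sigmoid (b₀ + b₁ * (x + u)) := by
      intro u
      rw [← mul_assoc, ← Real.exp_add]
      ring_nf
    simp_rw [hfun] at hcm
    rw [integral_const_mul, ← mul_assoc, ← Real.exp_add] at hcm
    have hsplit : ∫ u, g (x + u) ∂gaussianReal 0 w = (berksonResponse b₀ b₁ w x - 1) +
        A * ∫ u, Real.exp (-b₁' * (x + (u + w * b₁') - w * b₁')) *
          Real.sigmoid (b₀ + b₁ * (x + (u + w * b₁'))) ∂gaussianReal 0 w := by
      have hi : Integrable (fun u => Real.sigmoid (b₀ + b₁ * (x + u))) (gaussianReal 0 w) :=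
        integrable_sigmoid_comp _ (by fun_prop)
      have hj : Integrable (fun u => Real.exp (-b₁' * (x + (u + w * b₁') - w * b₁')) *
          Real.sigmoid (b₀ + b₁ * (x + (u + w * b₁')))) (gaussianReal 0 w) := by
        refine ((hint1 (x + w * b₁') (-b₁')).const_mul (Real.exp (-b₁' * x))).congr
          (.of_forall fun u => ?_)
        simp only
        rw [← mul_assoc, ← Real.exp_add]
        ring_nf
      have hi1 : Integrable (fun u => Real.sigmoid (b₀ + b₁ * (x + u)) - 1) (gaussianReal 0 w) :=
        hi.sub (integrable_const _)
      have hs : berksonResponse b₀ b₁ w x - 1 =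
          ∫ u, (Real.sigmoid (b₀ + b₁ * (x + u)) - 1) ∂gaussianReal 0 w := by
        rw [integral_sub hi (integrable_const _)]
        simp [berksonResponse]
      rw [hs, ← integral_const_mul,
        ← integral_add hi1 (hj.const_mul A)]
      refine integral_congr_ae (.of_forall fun u => ?_)
      simp only [g]
      ring_nf
    rw [hsplit, hcm, ← mul_assoc, hA, ← Real.exp_add, Real.sigmoid_def (b₀' + b₁' * x), mul_sub,
      mul_inv_cancel₀ (by positivity), berksonResponse]
    ring_nf
  have hzero : {x | berksonResponse b₀ b₁ w x - Real.sigmoid (b₀' + b₁' * x) = 0} =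
      {x | ∫ u, g (x + u) ∂gaussianReal 0 w = 0} := by
    ext x
    have : 1 + Real.exp (-(b₀' + b₁' * x)) ≠ 0 := by positivity
    simp only [Set.mem_ofPred_eq, hconv, mul_eq_zero, this, false_or]
  -- Clearing the two positive sigmoid denominators in `g` leaves four exponentials.
  have hsum : ∀ t, ∑ i, ![-1, -Real.exp (-b₀ - b₁ * (w * b₁')), A, A * Real.exp b₀] i *
      Real.exp (![0, -b₁, -b₁', b₁ - b₁'] i * t) =
      ((1 + Real.exp (b₀ + b₁ * t)) * (1 + Real.exp (-(b₀ + b₁ * (t + w * b₁'))))) * g t := by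
    intro t
    have e1 : Real.sigmoid (b₀ + b₁ * t) - 1 = -(1 + Real.exp (b₀ + b₁ * t))⁻¹ := by
      rw [← neg_neg (b₀ + b₁ * t), Real.sigmoid_neg, Real.sigmoid_def]
      simp
    have p1 : 1 + Real.exp (b₀ + b₁ * t) ≠ 0 := by positivity
    have p2 : 1 + Real.exp (-(b₀ + b₁ * (t + w * b₁'))) ≠ 0 := by positivity
    have e2 : ((1 + Real.exp (b₀ + b₁ * t)) * (1 + Real.exp (-(b₀ + b₁ * (t + w * b₁'))))) * g t =
        -(1 + Real.exp (-(b₀ + b₁ * (t + w * b₁')))) +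
          A * Real.exp (-b₁' * t) * (1 + Real.exp (b₀ + b₁ * t)) := by
      simp only [g]
      rw [e1, Real.sigmoid_def]
      field_simp
    have e3 : Real.exp (-(b₀ + b₁ * (t + w * b₁'))) =
        Real.exp (-b₀ - b₁ * (w * b₁')) * Real.exp (-b₁ * t) := by
      rw [← Real.exp_add]
      ring_nf
    have e4 : Real.exp ((b₁ - b₁') * t) = Real.exp (b₁ * t) * Real.exp (-b₁' * t) := by
      rw [← Real.exp_add]
      ring_nf
    rw [e2, e3, Real.exp_add]
    simp only [Fin.sum_univ_four, Matrix.cons_val, e4, zero_mul, Real.exp_zero]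
    ring
  have hgz : {t | g t = 0} =
      {t | ∑ i, ![-1, -Real.exp (-b₀ - b₁ * (w * b₁')), A, A * Real.exp b₀] i *
        Real.exp (![0, -b₁, -b₁', b₁ - b₁'] i * t) = 0} := by
    ext t
    have p1 : 1 + Real.exp (b₀ + b₁ * t) ≠ 0 := by positivity
    have p2 : 1 + Real.exp (-(b₀ + b₁ * (t + w * b₁'))) ≠ 0 := by positivity
    simp only [Set.mem_ofPred_eq, hsum, mul_eq_zero, p1, p2, false_or]
  rw [hzero]
  refine (encard_zeros_gaussian_conv_le hgc hgint).trans ?_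
  rw [hgz]
  refine encard_zeros_exp_sum_le 3 _ _ ?_
  by_contra! hall
  exact hne (eq_of_exp_sum_eq_zero hall)

/-- With `v = v' + w`, the difference of responses is the `N(0, v')` convolution of a Berkson
response of variance `w` minus a plain logistic one. -/
theorem encard_berksonResponse_eq_le_of_le {b₀ b₁ b₀' b₁' : ℝ} {v v' : ℝ≥0} (hv : v' ≤ v)
    (hne : ¬ (b₀ = b₀' ∧ b₁ = b₁' ∧ b₁ ^ 2 * (v : ℝ) = b₁' ^ 2 * (v' : ℝ))) :
    {x | berksonResponse b₀ b₁ v x = berksonResponse b₀' b₁' v' x}.encard ≤ 3 := by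
  obtain ⟨w, rfl⟩ := exists_add_of_le hv
  let D : ℝ → ℝ := fun x => berksonResponse b₀ b₁ w x - Real.sigmoid (b₀' + b₁' * x)
  have hDc : Continuous D :=
    (continuous_berksonResponse b₀ b₁ w).sub (continuous_sigmoid_affine b₀' b₁')
  have hDb : ∀ x, |D x| ≤ 2 := fun x => (abs_sub _ _).trans (by
    linarith [abs_berksonResponse_le_one b₀ b₁ w x, abs_sigmoid_le_one (b₀' + b₁' * x)])
  have hset : {x | berksonResponse b₀ b₁ (v' + w) x = berksonResponse b₀' b₁' v' x} =
      {x | ∫ u, D (x + u) ∂gaussianReal 0 v' = 0} := by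
    ext x
    have hi : Integrable (fun u => berksonResponse b₀ b₁ w (x + u)) (gaussianReal 0 v') :=
      Integrable.of_bound ((continuous_berksonResponse b₀ b₁ w).comp
        (continuous_const_add x)).aestronglyMeasurable 1
        (.of_forall fun _ => abs_berksonResponse_le_one _ _ _ _)
    simp only [Set.mem_ofPred_eq, D]
    rw [integral_sub hi (integrable_sigmoid_comp _ (by fun_prop)), ← berksonResponse_add,
      sub_eq_zero]
    rfl
  rw [hset]
  refine (encard_zeros_gaussian_conv_le hDc fun y =>
    integrable_exp_mul_mul_gaussianReal v' y 2 hDc hDb).trans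
    (encard_berksonResponse_eq_sigmoid_le ?_)
  rintro ⟨h0, rfl, h2⟩
  exact hne ⟨h0, rfl, by push_cast; linear_combination h2⟩

/-- Two Berkson responses with distinguishable parameters agree in at most three points. -/
theorem encard_berksonResponse_eq_le {b₀ b₁ b₀' b₁' : ℝ} {v v' : ℝ≥0}
    (hne : ¬ (b₀ = b₀' ∧ b₁ = b₁' ∧ b₁ ^ 2 * (v : ℝ) = b₁' ^ 2 * (v' : ℝ))) :
    {x | berksonResponse b₀ b₁ v x = berksonResponse b₀' b₁' v' x}.encard ≤ 3 := by
  rcases le_total v' v with h | h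
  · exact encard_berksonResponse_eq_le_of_le h hne
  · simp_rw [eq_comm (a := berksonResponse b₀ b₁ v _)]
    exact encard_berksonResponse_eq_le_of_le h fun ⟨h0, h1, h2⟩ => hne ⟨h0.symm, h1.symm, h2.symm⟩

/-! ### From the observed law to the response -/

/-- In the Berkson logistic model, `P(X₀ ∈ s, Y = 1)` is the integral of the Berkson response
over `s` with respect to the law of `X₀`. -/
theorem IsStructuralBerksonLogistic.setIntegral_berksonResponse {Ω : Type*} [MeasurableSpace Ω]
    {P : Measure Ω} {X₀ U X : Ω → ℝ} {Y : Ω → Fin 2} {θ : BerksonParam}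
    (hM : IsStructuralBerksonLogistic P X₀ U X Y θ) {s : Set ℝ} (hs : MeasurableSet s) :
    ∫ x in s, berksonResponse θ.β₀ θ.β₁ θ.tauSq x ∂P.map X₀ =
      (P.map (fun ω => (X₀ ω, Y ω))).real (s ×ˢ {1}) := by
  have := hM.isProbabilityMeasure
  have hX₀ := hM.measurable_X₀
  have hU := hM.measurable_U
  have hY := hM.measurable_Y
  have hX : Measurable X := by
    rw [funext hM.X_eq]
    exact hX₀.add hU
  have hm : MeasurableSpace.comap (fun ω => (X₀ ω, X ω)) inferInstance ≤ ‹MeasurableSpace Ω› :=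
    (hX₀.prodMk hX).comap_le
  have hY1 : MeasurableSet (Y ⁻¹' {1}) := hY (measurableSet_singleton 1)
  have hprob : IsProbabilityMeasure (P.map X₀) := Measure.isProbabilityMeasure_map hX₀.aemeasurable
  have hjoint := (indepFun_iff_map_prod_eq_prod_map_map hX₀.aemeasurable hU.aemeasurable).1 hM.indep
  rw [hM.law_U] at hjoint
  have hF : Measurable fun p : ℝ × ℝ => Real.sigmoid (θ.β₀ + θ.β₁ * (p.1 + p.2)) :=
    continuous_sigmoid.measurable.comp (by fun_prop)
  calc ∫ x in s, berksonResponse θ.β₀ θ.β₁ θ.tauSq x ∂P.map X₀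
      = ∫ p in s ×ˢ Set.univ, Real.sigmoid (θ.β₀ + θ.β₁ * (p.1 + p.2))
          ∂(P.map X₀).prod (gaussianReal 0 θ.tauSq) := by
        rw [setIntegral_prod _ (integrable_sigmoid_comp _ (by fun_prop)).integrableOn]
        simp [berksonResponse]
    _ = ∫ ω in X₀ ⁻¹' s, Real.sigmoid (θ.β₀ + θ.β₁ * (X₀ ω + U ω)) ∂P := by
        rw [← hjoint, setIntegral_map (hs.prod .univ) hF.aestronglyMeasurable
          (hX₀.prodMk hU).aemeasurable, Set.mk_preimage_prod, Set.preimage_univ, Set.inter_univ]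
    _ = ∫ ω in X₀ ⁻¹' s, (P⟦Y ⁻¹' {1} |
          MeasurableSpace.comap (fun ω => (X₀ ω, X ω)) inferInstance⟧) ω ∂P := by
        refine setIntegral_congr_ae (hX₀ hs) ?_
        filter_upwards [hM.condProb] with ω hω _
        rw [hω, hM.X_eq, Real.sigmoid_def, Real.exp_neg]
        have : 0 < Real.exp (θ.β₀ + θ.β₁ * (X₀ ω + U ω)) := Real.exp_pos _
        field_simp
        ring
    _ = ∫ ω in X₀ ⁻¹' s, (Y ⁻¹' {1}).indicator (fun _ => (1 : ℝ)) ω ∂P := by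
        refine setIntegral_condExp hm ((integrable_const 1).indicator hY1) ?_
        exact ⟨s ×ˢ Set.univ, hs.prod .univ, by ext; simp⟩
    _ = _ := by
        rw [setIntegral_indicator hY1, setIntegral_const, smul_eq_mul, mul_one,
          map_measureReal_apply (hX₀.prodMk hY) (hs.prod (measurableSet_singleton 1)),
          Set.mk_preimage_prod]

theorem mainTheorem1
    {Ω : Type*} [MeasurableSpace Ω] (P : Measure Ω)
    (X₀ U X : Ω → ℝ) (Y : Ω → Fin 2) (θ : BerksonParam)
    {Ω' : Type*} [MeasurableSpace Ω'] (P' : Measure Ω')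
    (X₀' U' X' : Ω' → ℝ) (Y' : Ω' → Fin 2) (θ' : BerksonParam)
    -- two instances of the model, with possibly different parameter values
    (hM : IsStructuralBerksonLogistic P X₀ U X Y θ)
    (hM' : IsStructuralBerksonLogistic P' X₀' U' X' Y' θ')
    -- the law of `X₀` is not concentrated at three or fewer points
    (hX₀ : ¬ ∃ S : Finset ℝ, S.card ≤ 3 ∧ (P.map X₀) (S : Set ℝ) = 1)
    -- the observations `(X₀, Y)` have the same joint law
    (hlaw : P.map (fun ω => (X₀ ω, Y ω)) = P'.map (fun ω => (X₀' ω, Y' ω))) :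
    θ.β₀ = θ'.β₀ ∧ θ.β₁ = θ'.β₁ ∧
      θ.β₁ ^ 2 * (θ.tauSq : ℝ) = θ'.β₁ ^ 2 * (θ'.tauSq : ℝ) := by
  have := hM.isProbabilityMeasure
  have := hM'.isProbabilityMeasure
  have hX := hM.measurable_X₀
  have hX' := hM'.measurable_X₀
  have hprob : IsProbabilityMeasure (P.map X₀) := Measure.isProbabilityMeasure_map hX.aemeasurable
  have hmarg : P.map X₀ = P'.map X₀' := by
    have h := congrArg (Measure.map Prod.fst) hlaw
    rwa [Measure.map_map measurable_fst (hX.prodMk hM.measurable_Y),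
      Measure.map_map measurable_fst (hX'.prodMk hM'.measurable_Y)] at h
  have hint : ∀ b₀ b₁ v, Integrable (berksonResponse b₀ b₁ v) (P.map X₀) := fun b₀ b₁ v =>
    Integrable.of_bound (continuous_berksonResponse b₀ b₁ v).aestronglyMeasurable 1
      (.of_forall fun _ => abs_berksonResponse_le_one _ _ _ _)
  have hae : berksonResponse θ.β₀ θ.β₁ θ.tauSq =ᵐ[P.map X₀]
      berksonResponse θ'.β₀ θ'.β₁ θ'.tauSq := by
    -- The integral over each `s` is the probability of `s ×ˢ {1}` under the common joint law.
    refine Integrable.ae_eq_of_forall_setIntegral_eq _ _ (hint _ _ _) (hint _ _ _) fun s hs _ => ?_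
    rw [hM.setIntegral_berksonResponse hs, hlaw, ← hM'.setIntegral_berksonResponse hs, hmarg]
  by_contra hne
  have hcard := encard_berksonResponse_eq_le hne
  have hfin := Set.finite_of_encard_le_coe (k := 3) hcard
  -- The coincidence set of the two responses carries the whole law of `X₀`.
  refine hX₀ ⟨hfin.toFinset, ?_, ?_⟩
  · rw [hfin.encard_eq_coe_toFinset_card] at hcard
    exact_mod_cast hcard
  · rw [hfin.coe_toFinset]
    exact prob_compl_eq_zero_iff (hfin.measurableSet) |>.1 hae
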